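/- Let $\mathcal A$ be a finite alphabet with $k=\#\mathcal A$ letters, and let $\mathbf u=u_0u_1u_2\cdots$ be an infinite word over $\mathcal A$ in which every letter of $\mathcal A$ occurs. A factor of $\mathbf u$ is a finite word (possibly empty) of the form $u_iu_{i+1}\cdots u_{i+n-1}$, and the index $i$ is then called an occurrence of it. Assume that - $\mathbf u$ is uniformly recurrent: every factor of $\mathbf u$ occurs infinitely often, and the distances between its successive occurrences are bounded; - $\mathbf u$ has Property $\mathcal{PE}$: every palindromic factor $w$ of $\mathbf u$ (including the empty word) has a unique palindromic extension in $\mathbf u$, i.e. there is exactly one letter $a\in\mathcal A$ such that $awa$ is a factor of $\mathbf u$. Then $\mathbf u$ is rich, i.e. every factor $w$ of $\mathbf u$ contains exactly $|w|+1$ distinct palindromes (the empty word included), if and only if $\mathbf u$ has Property $\mathcal R$: every factor $w$ of $\mathbf u$ has exactly $k$ return words, where a return word of $w$ is a word $u_iu_{i+1}\cdots u_{j-1}$ with $i<j$ two successive occurrences of $w$ in $\mathbf u$. -/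

import Mathlib

/-!
Combinatorics on words. An infinite word over an alphabet `A` is a map `u : ℕ → A`;
finite words are lists, with `[]` the empty word.
-/

namespace InfWord

variable {A : Type*}

/-- The finite word `u_i u_{i+1} ⋯ u_{i+n-1}`. -/
def block (u : ℕ → A) (i n : ℕ) : List A :=
  List.ofFn fun j : Fin n => u (i + j)

/-- The index `i` is an occurrence of the finite word `w` in `u`. -/
def OccursAt (u : ℕ → A) (w : List A) (i : ℕ) : Prop :=
  block u i w.length = w

/-- The language of `u`: the set of all its (finite) factors. -/
def language (u : ℕ → A) : Set (List A) :=
  {w | ∃ i, OccursAt u w i}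

/-- `i < j` are two successive occurrences of `w` in `u`. -/
def SuccessiveOccurrences (u : ℕ → A) (w : List A) (i j : ℕ) : Prop :=
  i < j ∧ OccursAt u w i ∧ OccursAt u w j ∧ ∀ l, i < l → l < j → ¬ OccursAt u w l

/-- Every factor of `u` occurs infinitely often, and the distances between its successive
occurrences are bounded. -/
def UniformlyRecurrent (u : ℕ → A) : Prop :=
  ∀ w ∈ language u, {i | OccursAt u w i}.Infinite ∧
    ∃ N : ℕ, ∀ i j, SuccessiveOccurrences u w i j → j - i ≤ N

/-- The set of return words of `w` in `u`: the words `u_i u_{i+1} ⋯ u_{j-1}` where `i < j` are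
successive occurrences of `w`. -/
def returnWords (u : ℕ → A) (w : List A) : Set (List A) :=
  {v | ∃ i j, SuccessiveOccurrences u w i j ∧ v = block u i (j - i)}

/-- The palindromic extensions of `w` in `u`: the factors of `u` of the form `a w a` with `a` a
letter (used for palindromes `w`). -/
def palindromicExtensions (u : ℕ → A) (w : List A) : Set (List A) :=
  {v | v ∈ language u ∧ ∃ a : A, v = a :: (w ++ [a])}

/-- Property PE: every palindromic factor of `u` (the empty word included) has a unique palindromic
extension in `u`. -/
def PropertyPE (u : ℕ → A) : Prop :=
  ∀ w ∈ language u, w.Palindrome → ∃! v, v ∈ palindromicExtensions u w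

/-- Property R: every factor of `u` has exactly `k` return words, `k` the size of the alphabet. -/
def PropertyR (u : ℕ → A) : Prop :=
  ∀ w ∈ language u, (returnWords u w).encard = ENat.card A

/-- The palindromes (the empty word included) contained in the finite word `w`. -/
def palindromicFactors (w : List A) : Set (List A) :=
  {p | p <:+: w ∧ p.Palindrome}

/-- `u` is rich in palindromes: every factor `w` of `u` contains `|w| + 1` distinct palindromes. -/
def Rich (u : ℕ → A) : Prop :=
  ∀ w ∈ language u, (palindromicFactors w).encard = (w.length : ℕ∞) + 1

end InfWord

namespace InfWord

/-! ### Occurrences and their transport by translation and reflection -/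

variable {A : Type*} {u : ℕ → A}

/-! By PE, a palindromic factor is determined by its center (a letter or the empty word) and its
number of layers: there are k+1 centers. Uniform recurrence makes each center `c` yield a shortest
palindrome `firstPal u w c` containing `w`. When longer than `w`, it has `w` or its reversal at both
ends and neither strictly inside (`mirrorSuccessive_of_firstPal`).

For a palindrome `w`, the k centers other than its own thus give k palindromic complete return
words. Richness amounts to all complete returns of palindromes being palindromes, which settles the
palindromic case in both directions; in particular R implies richness.

For `w` not a palindrome and `u` rich, `u` is covered, from the first occurrence of `w` or its
reversal on, by palindromes `firstPal u w c` overlapping in `w` and its reversal alternately, so a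
return word of `w` is a passage across two of them. Passages form a graph on the k+1 centers. It is
connected, since all centers occur along `u`, and acyclic, since the net number of crossings of an
edge vanishes between successive occurrences of a given palindrome, by reflection
(`card_followedAt_le`). A tree on k+1 vertices has k edges, and these correspond to the return
words. -/

@[simp] theorem length_block (u : ℕ → A) (i n : ℕ) : (block u i n).length = n := by
  simp [block]

theorem occursAt_iff_getElem {w : List A} {i : ℕ} :
    OccursAt u w i ↔ ∀ (j : ℕ) (h : j < w.length), u (i + j) = w[j] := by
  unfold OccursAt block
  constructor
  · intro h j hj
    conv_rhs => rw [List.getElem_of_eq h.symm hj]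
    simp
  · intro h
    apply List.ext_getElem
    · simp
    · intro j h1 h2
      simpa using h j h2

theorem occursAt_block (u : ℕ → A) (i n : ℕ) : OccursAt u (block u i n) i := by
  simp [OccursAt]

theorem block_mem_language (u : ℕ → A) (i n : ℕ) : block u i n ∈ language u :=
  ⟨i, occursAt_block u i n⟩

theorem occursAt_append {v w : List A} {i : ℕ} :
    OccursAt u (v ++ w) i ↔ OccursAt u v i ∧ OccursAt u w (i + v.length) := by
  simp only [occursAt_iff_getElem]
  constructor
  · intro h
    refine ⟨fun j hj => ?_, fun j hj => ?_⟩
    · rw [h j (by simp; omega), List.getElem_append_left]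
    · rw [add_assoc, h (v.length + j) (by simp; omega), List.getElem_append_right (by omega)]
      simp only [Nat.add_sub_cancel_left]
  · rintro ⟨h1, h2⟩ j hj
    rw [List.length_append] at hj
    by_cases h : j < v.length
    · rw [List.getElem_append_left h, h1]
    · rw [List.getElem_append_right (by omega), ← h2 _ (by omega)]
      congr 1
      omega

theorem OccursAt.eq_of_length_eq {v w : List A} {i : ℕ} (hv : OccursAt u v i)
    (hw : OccursAt u w i) (h : v.length = w.length) : v = w := by
  unfold OccursAt at hv hw
  rw [← hv, ← hw, h]

theorem OccursAt.eq_block {v : List A} {i : ℕ} (hv : OccursAt u v i) :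
    v = block u i v.length := hv.symm

theorem block_add (u : ℕ → A) (i m n : ℕ) :
    block u i (m + n) = block u i m ++ block u (i + m) n := by
  refine (occursAt_block u i (m + n)).eq_of_length_eq (occursAt_append.2 ⟨?_, ?_⟩) (by simp)
  · exact occursAt_block u i m
  · simpa using occursAt_block u (i + m) n

theorem OccursAt.exists_of_infix {v w : List A} {i : ℕ} (hv : OccursAt u v i) (h : w <:+: v) :
    ∃ j, j + w.length ≤ v.length ∧ OccursAt u w (i + j) := by
  obtain ⟨s, t, rfl⟩ := h
  rw [occursAt_append, occursAt_append] at hv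
  exact ⟨s.length, by simp, hv.1.2⟩

theorem OccursAt.infix {v w : List A} {i j : ℕ} (hv : OccursAt u v i)
    (hw : OccursAt u w (i + j)) (h : j + w.length ≤ v.length) : w <:+: v := by
  obtain ⟨k, hk⟩ := Nat.exists_eq_add_of_le h
  rw [hv.eq_block, hw.eq_block, hk, block_add, block_add]
  exact ⟨_, _, rfl⟩

theorem OccursAt.prefix {v w : List A} {i : ℕ} (hv : OccursAt u v i)
    (hw : OccursAt u w i) (h : w.length ≤ v.length) : w <+: v := by
  obtain ⟨k, hk⟩ := Nat.exists_eq_add_of_le h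
  rw [hv.eq_block, hw.eq_block, hk, block_add]
  exact ⟨_, rfl⟩

theorem OccursAt.of_prefix {v w : List A} {i : ℕ} (hv : OccursAt u v i) (h : w <+: v) :
    OccursAt u w i := by
  obtain ⟨t, rfl⟩ := h
  exact (occursAt_append.1 hv).1

theorem mem_language_of_infix {v w : List A} (hv : v ∈ language u) (h : w <:+: v) :
    w ∈ language u := by
  obtain ⟨i, hi⟩ := hv
  obtain ⟨j, -, hj⟩ := hi.exists_of_infix h
  exact ⟨_, hj⟩

theorem OccursAt.transfer {v w : List A} {i i' j : ℕ} (hv : OccursAt u v i)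
    (hv' : OccursAt u v i') (hw : OccursAt u w (i + j)) (h : j + w.length ≤ v.length) :
    OccursAt u w (i' + j) := by
  rw [occursAt_iff_getElem] at hv hv' hw ⊢
  intro l hl
  rw [← hw l hl, add_assoc, add_assoc, hv _ (by omega), hv' _ (by omega)]

theorem OccursAt.transfer_reverse {v w : List A} {i i' j : ℕ} (hv : OccursAt u v i)
    (hv' : OccursAt u v.reverse i') (hw : OccursAt u w (i + j)) (h : j + w.length ≤ v.length) :
    OccursAt u w.reverse (i' + (v.length - w.length - j)) := by
  rw [occursAt_iff_getElem] at hv hv' hw ⊢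
  intro l hl
  rw [List.length_reverse] at hl
  rw [List.getElem_reverse, ← hw, add_assoc, hv' _ (by rw [List.length_reverse]; omega),
    add_assoc, hv _ (by omega), List.getElem_reverse]
  congr 1
  omega

/-- The reflection principle behind all later symmetry arguments; the bound on `j` makes the
truncated subtractions exact. -/
theorem OccursAt.mirror {v w : List A} {i j : ℕ} (hv : OccursAt u v i) (hp : v.Palindrome)
    (hw : OccursAt u w (i + j)) (h : j + w.length ≤ v.length) :
    OccursAt u w.reverse (i + (v.length - w.length - j)) :=
  hv.transfer_reverse (by rwa [hp.reverse_eq]) hw h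

/-! ### Occurrences up to reversal -/

/-- `p` is an occurrence of `w` or of its reversal. -/
def MirrorOccursAt (u : ℕ → A) (w : List A) (p : ℕ) : Prop :=
  OccursAt u w p ∨ OccursAt u w.reverse p

/-- `p < q` are two successive elements of the set of occurrences of `w` or of its reversal. -/
def MirrorSuccessive (u : ℕ → A) (w : List A) (p q : ℕ) : Prop :=
  p < q ∧ MirrorOccursAt u w p ∧ MirrorOccursAt u w q ∧
    ∀ l, p < l → l < q → ¬ MirrorOccursAt u w l

theorem mirrorOccursAt_iff {w : List A} (hw : w.Palindrome) {p : ℕ} :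
    MirrorOccursAt u w p ↔ OccursAt u w p := by
  simp [MirrorOccursAt, hw.reverse_eq]

theorem mirrorSuccessive_iff {w : List A} (hw : w.Palindrome) {p q : ℕ} :
    MirrorSuccessive u w p q ↔ SuccessiveOccurrences u w p q := by
  simp only [MirrorSuccessive, SuccessiveOccurrences, mirrorOccursAt_iff hw]

theorem MirrorSuccessive.le_of_lt {w : List A} {p q r : ℕ} (h : MirrorSuccessive u w p q)
    (hr : MirrorOccursAt u w r) (hpr : p < r) : q ≤ r := by
  by_contra hlt
  exact h.2.2.2 r hpr (by omega) hr

theorem MirrorSuccessive.unique {w : List A} {p q r : ℕ} (h : MirrorSuccessive u w p q)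
    (h' : MirrorSuccessive u w p r) : q = r :=
  le_antisymm (h.le_of_lt h'.2.2.1 h'.1) (h'.le_of_lt h.2.2.1 h.1)

/-- Each occurrence but the first one has a predecessor. -/
theorem exists_successiveOccurrences {w : List A} {i j : ℕ} (hi : OccursAt u w i)
    (hj : OccursAt u w j) (hij : i < j) :
    ∃ q, i ≤ q ∧ SuccessiveOccurrences u w q j := by
  classical
  have hP : i < j ∧ OccursAt u w i := ⟨hij, hi⟩
  have hs := Nat.findGreatest_spec (P := fun q => q < j ∧ OccursAt u w q) hij.le hP
  refine ⟨_, Nat.le_findGreatest hij.le hP, hs.1, hs.2, hj, fun l h1 h2 h3 => ?_⟩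
  exact Nat.findGreatest_is_greatest h1 h2.le ⟨h2, h3⟩

/-! ### Richness and palindromic complete returns -/

/-- In a rich word every factor ends with a palindrome that it contains only once. -/
theorem Rich.exists_new_palindrome (h : Rich u) (i m : ℕ) :
    ∃ j l, j + l = m + 1 ∧ (block u (i + j) l).Palindrome ∧
      ∀ r, r < j → ¬ OccursAt u (block u (i + j) l) (i + r) := by
  have h1 := h _ (block_mem_language u i (m + 1))
  have h0 := h _ (block_mem_language u i m)
  rw [length_block] at h1 h0
  have hns : ¬ palindromicFactors (block u i (m + 1)) ⊆ palindromicFactors (block u i m) := by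
    intro hs
    have := Set.encard_le_encard hs
    rw [h1, h0] at this
    norm_cast at this
    omega
  obtain ⟨p, ⟨hp, hpp⟩, hp0⟩ := Set.not_subset.1 hns
  obtain ⟨j, hj, hoj⟩ := (occursAt_block u i (m + 1)).exists_of_infix hp
  rw [length_block] at hj
  have key : ∀ r, OccursAt u p (i + r) → m < r + p.length := by
    intro r hr
    by_contra hle
    exact hp0 ⟨(occursAt_block u i m).infix hr (by simp; omega), hpp⟩
  have := key j hoj
  refine ⟨j, p.length, by omega, ?_, ?_⟩
  · rwa [← hoj.eq_block]
  · intro r hr hor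
    rw [← hoj.eq_block] at hor
    have := key r hor
    omega

/-- In a rich word, the factor between two successive occurrences of a word or its reversal is a
palindrome. -/
theorem Rich.palindrome_of_mirrorSuccessive (h : Rich u) {w : List A} {p q : ℕ}
    (hpq : MirrorSuccessive u w p q) : (block u p (q + w.length - p)).Palindrome := by
  obtain ⟨hlt, hp, hq, hno⟩ := hpq
  obtain ⟨j, l, hjl, hpal, hnew⟩ := h.exists_new_palindrome p (q + w.length - p - 1)
  have hq' : ∃ y, y.length = w.length ∧ OccursAt u y q ∧ (y = w ∨ y = w.reverse) :=
    hq.elim (fun h => ⟨w, rfl, h, Or.inl rfl⟩) (fun h => ⟨_, by simp, h, Or.inr rfl⟩)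
  obtain ⟨y, hyl, hy, hyw⟩ := hq'
  set P := block u (p + j) l with hP
  have hPo : OccursAt u P (p + j) := occursAt_block _ _ _
  have hPl : P.length = l := by simp [hP]
  -- A short `P` would be a suffix of `y`; being a palindrome it also lies in the reversal of `y`,
  -- hence in the word at `p`, and is not new.
  by_cases hl : l ≤ w.length
  · exfalso
    have hin : P <:+: y := hy.infix (j := p + j - q) (by convert hPo using 1; omega) (by omega)
    have hin' : P <:+: y.reverse := by
      rw [← hpal.reverse_eq]
      exact List.reverse_infix.2 hin
    have hx : ∃ r, r + P.length ≤ w.length ∧ OccursAt u P (p + r) := by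
      rcases hp with hp | hp
      · refine hp.exists_of_infix ?_
        rcases hyw with rfl | rfl
        · exact hin
        · simpa using hin'
      · have := hp.exists_of_infix (w := P) ?_
        · simpa using this
        rcases hyw with rfl | rfl
        · exact hin'
        · exact hin
    obtain ⟨r, hr, hro⟩ := hx
    exact hnew r (by omega) hro
  -- Reflection in `P` carries `y` to the start of `P`, which must therefore be `p`.
  · have hm := hPo.mirror hpal (w := y) (j := q - (p + j)) (by convert hy using 1; omega)
      (by omega)
    have hpos : p + j + (P.length - y.length - (q - (p + j))) = p + j := by omega
    rw [hpos] at hm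
    have hT : MirrorOccursAt u w (p + j) := by
      rcases hyw with rfl | rfl
      · exact Or.inr hm
      · rw [List.reverse_reverse] at hm
        exact Or.inl hm
    have hj : j = 0 := by
      by_contra hj
      exact hno (p + j) (by omega) (by omega) hT
    subst hj
    have : l = q + w.length - p := by omega
    rw [hP, this] at hpal
    exact hpal

theorem palindromicFactors_nil : palindromicFactors ([] : List A) = {[]} := by
  ext p
  simp only [palindromicFactors, Set.mem_ofPred_eq, List.infix_nil, Set.mem_singleton_iff]
  exact ⟨fun h => h.1, fun h => ⟨h, h ▸ List.Palindrome.nil⟩⟩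

/-- A word is rich if its complete return words of palindromes are palindromes. -/
theorem rich_of_palindrome (h : ∀ (w : List A) (i j : ℕ), w.Palindrome →
    SuccessiveOccurrences u w i j → (block u i (j + w.length - i)).Palindrome) : Rich u := by
  have key : ∀ i m, (palindromicFactors (block u i m)).encard = (m : ℕ∞) + 1 := by
    intro i m
    induction m with
    | zero =>
      have : block u i 0 = [] := by simp [block]
      rw [this, palindromicFactors_nil]
      simp
    | succ m ih =>
      classical
      -- The least `j` gives the longest palindromic suffix `P`. An earlier copy of `P` would give a
      -- longer one through a complete return, and shorter palindromic suffixes reflect to earlier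
      -- positions; so exactly one palindrome is gained.
      have hex : ∃ j, j ≤ m ∧ (block u (i + j) (m + 1 - j)).Palindrome := by
        refine ⟨m, le_rfl, ?_⟩
        have : block u (i + m) (m + 1 - m) = [u (i + m)] := by simp [block]
        rw [this]
        exact List.Palindrome.singleton _
      obtain ⟨hjm, hjp⟩ := Nat.find_spec hex
      have hmin : ∀ r, r < Nat.find hex → ¬ (block u (i + r) (m + 1 - r)).Palindrome :=
        fun r hr hp => Nat.find_min hex hr ⟨by omega, hp⟩
      generalize Nat.find hex = j at hjm hjp hmin
      set P := block u (i + j) (m + 1 - j) with hP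
      have hPo : OccursAt u P (i + j) := occursAt_block _ _ _
      have hPl : P.length = m + 1 - j := by simp [hP]
      have hnot : P ∉ palindromicFactors (block u i m) := by
        rintro ⟨hin, -⟩
        obtain ⟨r, hr, hro⟩ := (occursAt_block u i m).exists_of_infix hin
        rw [length_block u i m] at hr
        obtain ⟨q, hq, hs⟩ := exists_successiveOccurrences hro hPo (by omega)
        have hqlt := hs.1
        have hp := h P q (i + j) hjp hs
        refine hmin (q - i) (by omega) ?_
        convert hp using 2 <;> omega
      have hins : palindromicFactors (block u i (m + 1)) =
          insert P (palindromicFactors (block u i m)) := by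
        ext p
        constructor
        · rintro ⟨hin, hp⟩
          obtain ⟨r, hr, hro⟩ := (occursAt_block u i (m + 1)).exists_of_infix hin
          rw [length_block] at hr
          rcases Nat.lt_or_ge m (r + p.length) with hlt | hle
          · have hrj : j ≤ r := by
              by_contra hrj
              refine hmin r (by omega) ?_
              have : m + 1 - r = p.length := by omega
              rwa [this, ← hro.eq_block]
            rcases hrj.eq_or_lt with rfl | hjr
            · exact Or.inl (hro.eq_of_length_eq hPo (by omega))
            · have hm := hPo.mirror hjp (w := p) (j := r - j)
                (by convert hro using 1; omega) (by omega)
              rw [hp.reverse_eq] at hm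
              have hpos : i + j + (P.length - p.length - (r - j)) = i + j := by omega
              rw [hpos] at hm
              exact Or.inr ⟨(occursAt_block u i m).infix hm (by simp; omega), hp⟩
          · exact Or.inr ⟨(occursAt_block u i m).infix hro (by simp; omega), hp⟩
        · rintro (rfl | ⟨hin, hp⟩)
          · exact ⟨(occursAt_block u i (m + 1)).infix hPo (by simp; omega), hjp⟩
          · refine ⟨hin.trans ?_, hp⟩
            rw [block_add]
            exact (List.prefix_append _ _).isInfix
      rw [hins, Set.encard_insert_of_notMem hnot, ih]
      push_cast
      rfl
  rintro w ⟨i, hi⟩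
  rw [hi.eq_block, key, length_block]

/-! ### Uniform recurrence -/

theorem occursAt_infinite_exists_ge (hur : UniformlyRecurrent u) {w : List A}
    (hw : w ∈ language u) (n : ℕ) : ∃ i, n ≤ i ∧ OccursAt u w i := by
  obtain ⟨i, hi, hn⟩ := (hur w hw).1.exists_gt n
  exact ⟨i, hn.le, hi⟩

theorem exists_successiveOccurrences_right (hur : UniformlyRecurrent u) {w : List A} {i : ℕ}
    (hi : OccursAt u w i) : ∃ j, SuccessiveOccurrences u w i j := by
  classical
  have hex : ∃ j, i < j ∧ OccursAt u w j := by
    obtain ⟨j, hj, hoj⟩ := occursAt_infinite_exists_ge hur ⟨i, hi⟩ (i + 1)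
    exact ⟨j, hj, hoj⟩
  exact ⟨Nat.find hex, (Nat.find_spec hex).1, hi, (Nat.find_spec hex).2,
    fun l h1 h2 h3 => Nat.find_min hex h2 ⟨h1, h3⟩⟩

/-- Every sufficiently long factor of a uniformly recurrent word contains a given factor. -/
theorem exists_forall_length_infix (hur : UniformlyRecurrent u) {w : List A}
    (hw : w ∈ language u) : ∃ N, ∀ v ∈ language u, N ≤ v.length → w <:+: v := by
  classical
  obtain ⟨N, hN⟩ := (hur w hw).2
  obtain ⟨p, hp⟩ := hw
  -- The summand `p` covers the start of `u`, where no occurrence of `w` need precede `i`.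
  have key : ∀ i, ∃ j, i ≤ j ∧ j ≤ i + N + p ∧ OccursAt u w j := by
    intro i
    by_cases hip : i ≤ p
    · exact ⟨p, hip, by omega, hp⟩
    · have hs := Nat.findGreatest_spec (P := fun q => OccursAt u w q) (n := i) (by omega) hp
      obtain ⟨j, hj⟩ := exists_successiveOccurrences_right hur hs
      have h1 := hN _ _ hj
      have h2 := Nat.findGreatest_le (P := fun q => OccursAt u w q) i
      have h3 : ∀ l, _ < l → l ≤ i → ¬ OccursAt u w l := fun l h h' =>
        Nat.findGreatest_is_greatest (P := fun q => OccursAt u w q) h h'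
      have h4 : i < j := by
        by_contra hle
        exact h3 j hj.1 (by omega) hj.2.2.1
      exact ⟨j, h4.le, by omega, hj.2.2.1⟩
  refine ⟨N + p + w.length, ?_⟩
  rintro v ⟨i, hi⟩ hv
  obtain ⟨j, h1, h2, h3⟩ := key i
  exact hi.infix (j := j - i) (by convert h3 using 1; omega) (by omega)

/-! ### Palindromic factors classified by center -/

open Classical in
/-- The letter of the palindromic extension of `w`. -/
noncomputable def extensionLetter (u : ℕ → A) (w : List A) : A :=
  if h : ∃ a, a :: (w ++ [a]) ∈ language u then h.choose else u 0

/-- The palindromic factors with a given center: a letter, or the empty word. -/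
noncomputable def centered (u : ℕ → A) (c : Option A) : ℕ → List A
  | 0 => c.toList
  | n + 1 => extensionLetter u (centered u c n) :: (centered u c n ++
      [extensionLetter u (centered u c n)])

theorem length_centered (c : Option A) (n : ℕ) :
    (centered u c n).length = 2 * n + c.toList.length := by
  induction n with
  | zero => simp [centered]
  | succ n ih => simp [centered, ih]; omega

theorem palindrome_centered (c : Option A) (n : ℕ) : (centered u c n).Palindrome := by
  induction n with
  | zero =>
    cases c
    · exact List.Palindrome.nil
    · exact List.Palindrome.singleton _
  | succ n ih => exact ih.cons_concat _

theorem mem_language_of_extension {a : A} {w : List A} (h : a :: (w ++ [a]) ∈ language u) :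
    w ∈ language u :=
  mem_language_of_infix h ⟨[a], [a], by simp⟩

theorem PropertyPE.extension_iff (hPE : PropertyPE u) {w : List A} (hw : w ∈ language u)
    (hp : w.Palindrome) {a : A} : a :: (w ++ [a]) ∈ language u ↔ a = extensionLetter u w := by
  obtain ⟨v, ⟨hv, b, rfl⟩, huniq⟩ := hPE w hw hp
  have hex : ∃ a, a :: (w ++ [a]) ∈ language u := ⟨b, hv⟩
  have hspec : extensionLetter u w :: (w ++ [extensionLetter u w]) ∈ language u := by
    unfold extensionLetter
    rw [dif_pos hex]
    exact hex.choose_spec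
  constructor
  · intro h
    have h1 := huniq _ ⟨h, a, rfl⟩
    have h2 := huniq _ ⟨hspec, _, rfl⟩
    exact (List.cons_eq_cons.1 (h1.trans h2.symm)).1
  · rintro rfl
    exact hspec

theorem PropertyPE.centered_mem (hPE : PropertyPE u) (hletters : Function.Surjective u)
    (c : Option A) (n : ℕ) : centered u c n ∈ language u := by
  induction n with
  | zero =>
    cases c with
    | none => exact ⟨0, by simp [OccursAt, block, centered]⟩
    | some a =>
      obtain ⟨i, rfl⟩ := hletters a
      exact ⟨i, by simp [OccursAt, block, centered]⟩
  | succ n ih => exact (hPE.extension_iff ih (palindrome_centered c n)).2 rfl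

/-- Peeling off outer letters, PE forces each layer, so only the center and the number of layers are
free. -/
theorem PropertyPE.eq_centered (hPE : PropertyPE u) {w : List A} (hp : w.Palindrome)
    (hw : w ∈ language u) : ∃ c n, w = centered u c n := by
  induction hp with
  | nil => exact ⟨none, 0, rfl⟩
  | singleton a => exact ⟨some a, 0, rfl⟩
  | @cons_concat a l hl ih =>
    have hl' := mem_language_of_extension hw
    obtain ⟨c, n, rfl⟩ := ih hl'
    rw [hPE.extension_iff hl' hl] at hw
    subst hw
    exact ⟨c, n + 1, rfl⟩

/-- The center contributes at most one letter, so the length fixes the rank; peeling equal layers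
then exposes the center. -/
theorem centered_injective {c d : Option A} {m n : ℕ} (h : centered u c m = centered u d n) :
    c = d ∧ m = n := by
  have hlen := congrArg List.length h
  rw [length_centered, length_centered] at hlen
  have hc : c.toList.length ≤ 1 := by cases c <;> simp
  have hd : d.toList.length ≤ 1 := by cases d <;> simp
  have hmn : m = n := by omega
  subst hmn
  refine ⟨?_, rfl⟩
  clear hlen
  induction m with
  | zero => cases c <;> cases d <;> simp_all [centered]
  | succ m ih =>
    apply ih
    simp only [centered, List.cons_eq_cons] at h
    exact (List.append_inj' h.2 (by simp)).1

theorem centered_add (c : Option A) (m n : ℕ) :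
    ∃ s t, s.length = n ∧ t.length = n ∧ centered u c (m + n) = s ++ centered u c m ++ t := by
  induction n with
  | zero => exact ⟨[], [], rfl, rfl, by simp⟩
  | succ n ih =>
    obtain ⟨s, t, hs, ht, h⟩ := ih
    refine ⟨extensionLetter u (centered u c (m + n)) :: s,
      t ++ [extensionLetter u (centered u c (m + n))], by simp [hs], by simp [ht], ?_⟩
    rw [← add_assoc, centered]
    generalize extensionLetter u (centered u c (m + n)) = a
    simp only [h, List.cons_append, List.append_assoc]

/-! ### Shortest palindromes containing a given factor -/

/-- The rank of the shortest palindrome with center `c` that contains `w`. -/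
noncomputable def firstRank (u : ℕ → A) (w : List A) (c : Option A) : ℕ :=
  sInf {n | w <:+: centered u c n}

/-- The shortest palindrome with center `c` that contains `w`. -/
noncomputable def firstPal (u : ℕ → A) (w : List A) (c : Option A) : List A :=
  centered u c (firstRank u w c)

theorem palindrome_firstPal (w : List A) (c : Option A) : (firstPal u w c).Palindrome :=
  palindrome_centered _ _

theorem firstPal_injective (w : List A) : Function.Injective (firstPal u w) :=
  fun _ _ h => (centered_injective h).1

theorem not_infix_of_lt_firstRank {w : List A} {c : Option A} {n : ℕ}
    (h : n < firstRank u w c) : ¬ w <:+: centered u c n :=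
  Nat.notMem_of_lt_sInf h

theorem firstRank_le {w : List A} {c : Option A} {n : ℕ} (h : w <:+: centered u c n) :
    firstRank u w c ≤ n :=
  Nat.sInf_le h

section

variable (hletters : Function.Surjective u) (hur : UniformlyRecurrent u) (hPE : PropertyPE u)

include hletters hur hPE

theorem infix_firstPal {w : List A} (hw : w ∈ language u) (c : Option A) :
    w <:+: firstPal u w c := by
  have hne : {n | w <:+: centered u c n}.Nonempty := by
    obtain ⟨N, hN⟩ := exists_forall_length_infix hur hw
    exact ⟨N, hN _ (hPE.centered_mem hletters c N) (by rw [length_centered]; omega)⟩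
  exact Nat.sInf_mem hne

theorem reverse_mem_language {w : List A} (hw : w ∈ language u) : w.reverse ∈ language u := by
  have h := List.reverse_infix.2 (infix_firstPal hletters hur hPE hw none)
  rw [(palindrome_firstPal w none).reverse_eq] at h
  exact mem_language_of_infix (hPE.centered_mem hletters _ _) h

/-- An occurrence strictly inside would survive removal of the outer layer, against minimality of
the rank. So `w` sits at an end, and reflection puts its reversal at the other. -/
theorem mirrorSuccessive_of_firstPal {w : List A} (hw : w ∈ language u) {c : Option A} {p : ℕ}
    (hp : OccursAt u (firstPal u w c) p) (hlt : w.length < (firstPal u w c).length) :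
    MirrorSuccessive u w p (p + (firstPal u w c).length - w.length) := by
  have hin := infix_firstPal hletters hur hPE hw c
  have hpal := palindrome_firstPal (u := u) w c
  -- no occurrence strictly inside
  have hno : ∀ j, 0 < j → j + w.length < (firstPal u w c).length →
      ¬ MirrorOccursAt u w (p + j) := by
    intro j h0 hj hT
    have hpos : 0 < firstRank u w c := by
      by_contra hz
      have h1 : (firstPal u w c).length ≤ 1 := by
        unfold firstPal
        rw [length_centered]
        have hc : c.toList.length ≤ 1 := by cases c <;> simp
        omega
      omega
    obtain ⟨m, hm⟩ : ∃ m, firstRank u w c = m + 1 := ⟨firstRank u w c - 1, by omega⟩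
    obtain ⟨s, t, hs, ht, hst⟩ := centered_add (u := u) c m 1
    have hlen : (firstPal u w c).length = (centered u c m).length + 2 := by
      unfold firstPal
      rw [length_centered, length_centered, hm]
      omega
    have hinner : OccursAt u (centered u c m) (p + 1) := by
      rw [firstPal, hm, hst, occursAt_append, occursAt_append, hs] at hp
      exact hp.1.2
    refine not_infix_of_lt_firstRank (u := u) (w := w) (c := c) (n := m) (by omega) ?_
    rcases hT with hT | hT
    · exact hinner.infix (j := j - 1) (by convert hT using 1; omega) (by omega)
    · have := hinner.infix (w := w.reverse) (j := j - 1) (by convert hT using 1; omega)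
        (by rw [List.length_reverse]; omega)
      have := List.reverse_infix.2 this
      rwa [(palindrome_centered c m).reverse_eq, List.reverse_reverse] at this
  obtain ⟨j, hj, hoj⟩ := hp.exists_of_infix hin
  have hm := hp.mirror hpal hoj hj
  have hends : MirrorOccursAt u w p ∧
      MirrorOccursAt u w (p + ((firstPal u w c).length - w.length)) := by
    rcases Nat.eq_zero_or_pos j with rfl | hjpos
    · exact ⟨Or.inl hoj, Or.inr hm⟩
    · have hj' : j + w.length = (firstPal u w c).length := by
        by_contra hne
        exact hno j hjpos (by omega) (Or.inl hoj)
      have h0 : (firstPal u w c).length - w.length - j = 0 := by omega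
      rw [h0] at hm
      have h1 : (firstPal u w c).length - w.length = j := by omega
      exact ⟨Or.inr hm, by rw [h1]; exact Or.inl hoj⟩
  refine ⟨by omega, hends.1, ?_, fun l h1 h2 => ?_⟩
  · convert hends.2 using 1
    omega
  · have := hno (l - p) (by omega) (by omega)
    rwa [Nat.add_sub_cancel' h1.le] at this

theorem exists_eq_firstPal {w : List A} (hw : w ∈ language u) {p q : ℕ}
    (hpq : MirrorSuccessive u w p q) (hpal : (block u p (q + w.length - p)).Palindrome) :
    ∃ c, block u p (q + w.length - p) = firstPal u w c := by
  obtain ⟨hlt, hp, hq, hno⟩ := hpq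
  obtain ⟨c, n, hcn⟩ := hPE.eq_centered hpal (block_mem_language _ _ _)
  have hlen := congrArg List.length hcn
  rw [length_block] at hlen
  refine ⟨c, ?_⟩
  have hin : w <:+: centered u c n := by
    rw [← hcn]
    rcases hp with hp | hp
    · exact (occursAt_block u p _).infix (j := 0) hp (by rw [length_block]; omega)
    · have := (occursAt_block u p (q + w.length - p)).infix (j := 0) hp
        (by rw [length_block, List.length_reverse]; omega)
      have := List.reverse_infix.2 this
      rwa [hpal.reverse_eq, List.reverse_reverse] at this
  rcases (firstRank_le hin).eq_or_lt with h | h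
  · rw [hcn, firstPal, h]
  · exfalso
    -- With `k > 0` superfluous layers, the inner `firstPal` would contain `w` strictly between `p`
    -- and `q`.
    obtain ⟨k, hk⟩ := Nat.exists_eq_add_of_le h.le
    obtain ⟨s, t, hs, ht, hst⟩ := centered_add (u := u) c (firstRank u w c) k
    rw [← hk, ← hcn] at hst
    have ho := occursAt_block u p (q + w.length - p)
    rw [hst, occursAt_append, occursAt_append, hs] at ho
    have hlen' := congrArg List.length hst
    simp only [List.length_append, length_block] at hlen'
    obtain ⟨j, hj, hoj⟩ := ho.1.2.exists_of_infix (infix_firstPal hletters hur hPE hw c)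
    exact hno (p + k + j) (by omega) (by omega) (Or.inl hoj)

end

/-! ### Return words of palindromes -/

/-- The complete return words of `w`: return words followed by `w`. -/
def completeReturns (u : ℕ → A) (w : List A) : Set (List A) :=
  {v | ∃ i j, SuccessiveOccurrences u w i j ∧ v = block u i (j + w.length - i)}

theorem encard_completeReturns (w : List A) :
    (completeReturns u w).encard = (returnWords u w).encard := by
  have himg : completeReturns u w = (fun v => v ++ w) '' returnWords u w := by
    have key : ∀ i j, SuccessiveOccurrences u w i j →
        block u i (j + w.length - i) = block u i (j - i) ++ w := by
      intro i j h
      have hlt := h.1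
      have h1 : j + w.length - i = (j - i) + w.length := by omega
      rw [h1, block_add, Nat.add_sub_cancel' hlt.le, ← h.2.2.1.eq_block]
    ext v
    constructor
    · rintro ⟨i, j, h, rfl⟩
      exact ⟨_, ⟨i, j, h, rfl⟩, (key i j h).symm⟩
    · rintro ⟨_, ⟨i, j, h, rfl⟩, rfl⟩
      exact ⟨i, j, h, (key i j h).symm⟩
  rw [himg]
  exact Function.Injective.encard_image (List.append_left_injective w) _

section

variable (hletters : Function.Surjective u) (hur : UniformlyRecurrent u) (hPE : PropertyPE u)

include hletters hur hPE

theorem length_lt_firstPal {w : List A} (hw : w ∈ language u) {c : Option A}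
    (h : firstPal u w c ≠ w) : w.length < (firstPal u w c).length := by
  have hin := infix_firstPal hletters hur hPE hw c
  rcases hin.length_le.eq_or_lt with h' | h'
  · exact absurd (hin.eq_of_length h').symm h
  · exact h'

theorem image_firstPal_subset {w : List A} (hw : w ∈ language u) (hp : w.Palindrome) :
    firstPal u w '' {c | firstPal u w c ≠ w} ⊆ completeReturns u w := by
  rintro _ ⟨c, hc, rfl⟩
  obtain ⟨p, ho⟩ := hPE.centered_mem hletters c (firstRank u w c)
  have hlt := length_lt_firstPal hletters hur hPE hw hc
  have hs := mirrorSuccessive_of_firstPal hletters hur hPE hw ho hlt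
  rw [mirrorSuccessive_iff hp] at hs
  refine ⟨_, _, hs, ?_⟩
  have : p + (firstPal u w c).length - w.length + w.length - p = (firstPal u w c).length := by
    omega
  rw [this]
  exact OccursAt.eq_block ho

/-- Of the k+1 centers only that of `w` itself has `firstPal u w c = w`. -/
theorem encard_image_firstPal [Finite A] {w : List A} (hw : w ∈ language u)
    (hp : w.Palindrome) :
    (firstPal u w '' {c | firstPal u w c ≠ w}).encard = ENat.card A := by
  rw [(firstPal_injective w).encard_image]
  obtain ⟨c, n, hcn⟩ := hPE.eq_centered hp hw
  have hc : firstPal u w c = w := by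
    have h1 : firstRank u w c ≤ n := firstRank_le (by rw [← hcn])
    have h2 := (infix_firstPal hletters hur hPE hw c).length_le
    have h3 := congrArg List.length hcn
    rw [firstPal, length_centered] at h2
    rw [length_centered] at h3
    have h4 : firstRank u w c = n := by omega
    rw [firstPal, h4, ← hcn]
  have hset : {c | firstPal u w c ≠ w} = Set.univ \ {c} := by
    ext d
    simp only [Set.mem_ofPred_eq, Set.mem_sdiff, Set.mem_univ, true_and, Set.mem_singleton_iff]
    rw [not_iff_not]
    exact ⟨fun h => firstPal_injective w (h.trans hc.symm), fun h => h ▸ hc⟩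
  rw [hset, Set.encard_sdiff_singleton_of_mem (Set.mem_univ c), Set.encard_univ]
  simp only [ENat.card_eq_coe_natCard, Finite.card_option]
  norm_cast

/-- The k palindromic complete returns already exhaust the number allowed by R, so no other complete
return exists. -/
theorem PropertyR.rich [Finite A] (hR : PropertyR u) : Rich u := by
  refine rich_of_palindrome fun w i j hp hij => ?_
  have hw : w ∈ language u := ⟨i, hij.2.1⟩
  have heq := Set.Finite.eq_of_subset_of_encard_le
    (Set.finite_of_encard_eq_coe (k := Nat.card A)
      (by
      rw [encard_image_firstPal hletters hur hPE hw hp, ENat.card_eq_coe_natCard]))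
    (image_firstPal_subset hletters hur hPE hw hp)
    (by rw [encard_image_firstPal hletters hur hPE hw hp, encard_completeReturns, hR w hw])
  have hmem : block u i (j + w.length - i) ∈ completeReturns u w := ⟨i, j, hij, rfl⟩
  rw [← heq] at hmem
  obtain ⟨c, -, hc⟩ := hmem
  rw [← hc]
  exact palindrome_firstPal w c

theorem Rich.encard_returnWords_of_palindrome [Finite A] (hrich : Rich u) {w : List A}
    (hw : w ∈ language u) (hp : w.Palindrome) : (returnWords u w).encard = ENat.card A := by
  rw [← encard_completeReturns, ← encard_image_firstPal hletters hur hPE hw hp]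
  congr 1
  refine Set.Subset.antisymm ?_ (image_firstPal_subset hletters hur hPE hw hp)
  rintro _ ⟨i, j, hij, rfl⟩
  have hlt := hij.1
  rw [← mirrorSuccessive_iff hp] at hij
  obtain ⟨c, hc⟩ := exists_eq_firstPal hletters hur hPE hw hij
    (hrich.palindrome_of_mirrorSuccessive hij)
  refine ⟨c, fun h => ?_, hc.symm⟩
  rw [h] at hc
  have := congrArg List.length hc
  rw [length_block] at this
  omega

end

/-! ### Non-palindromic factors: the tree of centers -/

/-- The occurrence at `p` of the palindrome with center `c` is followed by that of the palindrome
with center `d`, the two overlapping in `w` or its reversal. -/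
def FollowedAt (u : ℕ → A) (w : List A) (c d : Option A) (p : ℕ) : Prop :=
  OccursAt u (firstPal u w c) p ∧
    OccursAt u (firstPal u w d) (p + (firstPal u w c).length - w.length)

open Classical in
/-- The number of passages from `c` to `d` minus that of passages from `d` to `c`, before `p`. -/
noncomputable def potential (u : ℕ → A) (w : List A) (c d : Option A) (p : ℕ) : ℤ :=
  ∑ x ∈ Finset.range p,
    ((if FollowedAt u w c d x then 1 else 0) - (if FollowedAt u w d c x then 1 else 0))

theorem PropertyPE.exists_occursAt_firstPal (hPE : PropertyPE u)
    (hletters : Function.Surjective u) (w : List A) (c : Option A) :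
    ∃ p, OccursAt u (firstPal u w c) p :=
  hPE.centered_mem hletters c (firstRank u w c)

theorem exists_mirrorSuccessive (hur : UniformlyRecurrent u) {w : List A}
    (hw : w ∈ language u) {p : ℕ} (hp : MirrorOccursAt u w p) :
    ∃ q, MirrorSuccessive u w p q := by
  classical
  have hex : ∃ q, p < q ∧ MirrorOccursAt u w q := by
    obtain ⟨q, hq, ho⟩ := occursAt_infinite_exists_ge hur hw (p + 1)
    exact ⟨q, hq, Or.inl ho⟩
  exact ⟨Nat.find hex, (Nat.find_spec hex).1, hp, (Nat.find_spec hex).2,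
    fun l h1 h2 h3 => Nat.find_min hex h2 ⟨h1, h3⟩⟩

section

variable (hletters : Function.Surjective u) (hur : UniformlyRecurrent u) (hPE : PropertyPE u)
  {w : List A} (hw : w ∈ language u) (hnp : ¬ w.Palindrome)

include hletters hur hPE hw

theorem Rich.exists_firstPal_occursAt (hrich : Rich u) {p : ℕ} (hp : MirrorOccursAt u w p) :
    ∃ c, OccursAt u (firstPal u w c) p := by
  obtain ⟨q, hpq⟩ := exists_mirrorSuccessive hur hw hp
  obtain ⟨c, hc⟩ := exists_eq_firstPal hletters hur hPE hw hpq
    (hrich.palindrome_of_mirrorSuccessive hpq)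
  exact ⟨c, hc ▸ occursAt_block _ _ _⟩

include hnp

theorem length_lt_firstPal_of_not_palindrome (c : Option A) :
    w.length < (firstPal u w c).length :=
  length_lt_firstPal hletters hur hPE hw fun h => hnp (h ▸ palindrome_firstPal w c)

theorem mirrorSuccessive_firstPal {c : Option A} {p : ℕ} (hp : OccursAt u (firstPal u w c) p) :
    MirrorSuccessive u w p (p + (firstPal u w c).length - w.length) :=
  mirrorSuccessive_of_firstPal hletters hur hPE hw hp
    (length_lt_firstPal_of_not_palindrome hletters hur hPE hw hnp c)

/-- The next occurrence of `w` or its reversal fixes the length of the palindrome starting at `p`.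
-/
theorem eq_of_occursAt_firstPal {c d : Option A} {p : ℕ} (hc : OccursAt u (firstPal u w c) p)
    (hd : OccursAt u (firstPal u w d) p) : c = d := by
  have h := (mirrorSuccessive_firstPal hletters hur hPE hw hnp hc).unique
    (mirrorSuccessive_firstPal hletters hur hPE hw hnp hd)
  have h1 := length_lt_firstPal_of_not_palindrome hletters hur hPE hw hnp c
  have h2 := length_lt_firstPal_of_not_palindrome hletters hur hPE hw hnp d
  exact firstPal_injective w (hc.eq_of_length_eq hd (by omega))

theorem occursAt_iff_not_occursAt {c : Option A} {p : ℕ} (hp : OccursAt u (firstPal u w c) p) :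
    OccursAt u w p ↔ ¬ OccursAt u w (p + (firstPal u w c).length - w.length) := by
  have hlt := length_lt_firstPal_of_not_palindrome hletters hur hPE hw hnp c
  have hs := mirrorSuccessive_firstPal hletters hur hPE hw hnp hp
  have hpos : p + (firstPal u w c).length - w.length =
      p + ((firstPal u w c).length - w.length - 0) := by omega
  constructor
  · intro h h'
    have := hp.mirror (palindrome_firstPal w c) (j := 0) h (by omega)
    rw [← hpos] at this
    exact hnp (List.Palindrome.of_reverse_eq (this.eq_of_length_eq h' (by simp)))
  · intro h
    rcases hs.2.1 with h' | h'
    · exact h'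
    · have := hp.mirror (palindrome_firstPal w c) (j := 0) h' (by simp; omega)
      rw [List.reverse_reverse, List.length_reverse, ← hpos] at this
      exact absurd this h

theorem occursAt_iff_prefix {c : Option A} {p : ℕ} (hp : OccursAt u (firstPal u w c) p) :
    OccursAt u w p ↔ w <+: firstPal u w c :=
  ⟨fun h => hp.prefix h
    (length_lt_firstPal_of_not_palindrome hletters hur hPE hw hnp c).le, hp.of_prefix⟩

/-- `w` and its reversal alternate, so the centers are 2-colored by which of the two their
palindrome starts with. -/
theorem FollowedAt.prefix_iff {c d : Option A} {p : ℕ} (h : FollowedAt u w c d p) :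
    w <+: firstPal u w c ↔ ¬ w <+: firstPal u w d := by
  rw [← occursAt_iff_prefix hletters hur hPE hw hnp h.1,
    ← occursAt_iff_prefix hletters hur hPE hw hnp h.2]
  exact occursAt_iff_not_occursAt hletters hur hPE hw hnp h.1

theorem FollowedAt.ne {c d : Option A} {p : ℕ} (h : FollowedAt u w c d p) : c ≠ d := by
  rintro rfl
  have := h.prefix_iff hletters hur hPE hw hnp
  tauto

/-- The language is closed under reversal, and reversing the union of the two overlapping
palindromes exchanges their order. -/
theorem FollowedAt.exists_swap {c d : Option A} {p : ℕ} (h : FollowedAt u w c d p) :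
    ∃ q, FollowedAt u w d c q := by
  have h1 := length_lt_firstPal_of_not_palindrome hletters hur hPE hw hnp c
  have h2 := length_lt_firstPal_of_not_palindrome hletters hur hPE hw hnp d
  have hX := occursAt_block u p
    ((firstPal u w c).length + (firstPal u w d).length - w.length)
  have hXl := length_block u p
    ((firstPal u w c).length + (firstPal u w d).length - w.length)
  obtain ⟨q, hq⟩ := reverse_mem_language hletters hur hPE (block_mem_language u p
    ((firstPal u w c).length + (firstPal u w d).length - w.length))
  have hc := hX.transfer_reverse hq (j := 0) h.1 (by omega)
  have hd := hX.transfer_reverse hq (j := (firstPal u w c).length - w.length)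
    (by convert h.2 using 1; omega) (by omega)
  rw [(palindrome_firstPal w _).reverse_eq] at hc hd
  refine ⟨q, ?_, ?_⟩
  · convert hd using 1
    omega
  · convert hc using 1
    omega

/-- The passages between two successive occurrences of the palindrome with center `a` are mapped
to reversed passages by the reflection. -/
theorem card_followedAt_le (hrich : Rich u) {a : Option A} {p q : ℕ}
    (hpq : SuccessiveOccurrences u (firstPal u w a) p q) (c d : Option A)
    [DecidablePred (FollowedAt u w c d)] [DecidablePred (FollowedAt u w d c)] :
    ((Finset.Ico p q).filter (FollowedAt u w c d)).card ≤
      ((Finset.Ico p q).filter (FollowedAt u w d c)).card := by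
  have hB : (block u p (q + (firstPal u w a).length - p)).Palindrome :=
    hrich.palindrome_of_mirrorSuccessive
      ((mirrorSuccessive_iff (palindrome_firstPal w a)).2 hpq)
  obtain ⟨hlt, hp, hq, -⟩ := hpq
  have la := length_lt_firstPal_of_not_palindrome hletters hur hPE hw hnp a
  have lc := length_lt_firstPal_of_not_palindrome hletters hur hPE hw hnp c
  have ld := length_lt_firstPal_of_not_palindrome hletters hur hPE hw hnp d
  have hp1 := mirrorSuccessive_firstPal hletters hur hPE hw hnp hp
  have hq1 := mirrorSuccessive_firstPal hletters hur hPE hw hnp hq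
  have hBo := occursAt_block u p (q + (firstPal u w a).length - p)
  have hBl := length_block u p (q + (firstPal u w a).length - p)
  -- A passage starting in `[p, q)` ends within the palindromic complete return and beyond its first
  -- copy of `firstPal u w a`; these bounds put the reflected start back in `[p, q)`.
  have key : ∀ x, p ≤ x → x < q → FollowedAt u w c d x →
      x + (firstPal u w c).length + (firstPal u w d).length - w.length ≤
        q + (firstPal u w a).length ∧
      p + (firstPal u w a).length <
        x + (firstPal u w c).length + (firstPal u w d).length - w.length := by
    intro x hpx hxq hx
    have hx1 := mirrorSuccessive_firstPal hletters hur hPE hw hnp hx.1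
    have hx2 := mirrorSuccessive_firstPal hletters hur hPE hw hnp hx.2
    have e1 := hx1.le_of_lt hq1.2.1 hxq
    have e2 := hp1.le_of_lt hx1.2.2.1 (by omega)
    refine ⟨?_, by omega⟩
    rcases e1.eq_or_lt with e | e
    · rw [e] at hx2
      have := hx2.unique hq1
      omega
    · have := hx2.le_of_lt hq1.2.1 e
      omega
  refine Finset.card_le_card_of_injOn
    (fun x => p + q + (firstPal u w a).length + w.length - x - (firstPal u w c).length -
      (firstPal u w d).length) ?_ ?_
  · intro x hx
    simp only [Finset.coe_filter, Finset.mem_Ico, Set.mem_ofPred_eq] at hx ⊢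
    obtain ⟨⟨hpx, hxq⟩, hx⟩ := hx
    obtain ⟨k1, k2⟩ := key x hpx hxq hx
    refine ⟨⟨by omega, by omega⟩, ?_, ?_⟩
    · have := hBo.mirror hB (w := firstPal u w d)
        (j := x + (firstPal u w c).length - w.length - p)
        (by convert hx.2 using 1; omega) (by omega)
      rw [(palindrome_firstPal w _).reverse_eq] at this
      convert this using 1
      omega
    · have := hBo.mirror hB (w := firstPal u w c) (j := x - p)
        (by convert hx.1 using 1; omega) (by omega)
      rw [(palindrome_firstPal w _).reverse_eq] at this
      convert this using 1
      omega
  · intro x hx y hy hxy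
    simp only [Finset.coe_filter, Finset.mem_Ico, Set.mem_ofPred_eq] at hx hy hxy
    obtain ⟨k1, k2⟩ := key x hx.1.1 hx.1.2 hx.2
    obtain ⟨k3, k4⟩ := key y hy.1.1 hy.1.2 hy.2
    omega

theorem potential_eq_of_successive (hrich : Rich u) {a : Option A} {p q : ℕ}
    (hpq : SuccessiveOccurrences u (firstPal u w a) p q) (c d : Option A) :
    potential u w c d p = potential u w c d q := by
  classical
  have h1 := card_followedAt_le hletters hur hPE hw hnp hrich hpq c d
  have h2 := card_followedAt_le hletters hur hPE hw hnp hrich hpq d c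
  have h := le_antisymm h1 h2
  unfold potential
  rw [← Finset.sum_range_add_sum_Ico _ hpq.1.le, left_eq_add, Finset.sum_sub_distrib,
    Finset.sum_boole, Finset.sum_boole, h, sub_self]

/-- This makes the potential a function of the center alone. -/
theorem potential_eq_of_occursAt (hrich : Rich u) {a : Option A} (c d : Option A) {p q : ℕ}
    (hp : OccursAt u (firstPal u w a) p) (hq : OccursAt u (firstPal u w a) q) :
    potential u w c d p = potential u w c d q := by
  wlog hle : p ≤ q generalizing p q
  · exact (this hq hp (by omega)).symm
  induction q using Nat.strong_induction_on with
  | _ q ih =>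
    rcases hle.eq_or_lt with rfl | hlt
    · rfl
    · obtain ⟨r, hr, hs⟩ := exists_successiveOccurrences hp hq hlt
      rw [ih r hs.1 hs.2.1 hr]
      exact potential_eq_of_successive hletters hur hPE hw hnp hrich hs c d

open Classical in
-- No other passage starts before the next palindrome, so only the term at `p` can contribute.
theorem FollowedAt.potential_sub {a b : Option A} {p : ℕ} (h : FollowedAt u w a b p)
    (c d : Option A) :
    potential u w c d (p + (firstPal u w a).length - w.length) - potential u w c d p =
      (if FollowedAt u w c d p then 1 else 0) - (if FollowedAt u w d c p then 1 else 0) := by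
  have hs := mirrorSuccessive_firstPal hletters hur hPE hw hnp h.1
  unfold potential
  rw [← Finset.sum_range_add_sum_Ico _ hs.1.le, add_sub_cancel_left]
  have hno : ∀ c d x, x ∈ Finset.Ico p (p + (firstPal u w a).length - w.length) → x ≠ p →
      ¬ FollowedAt u w c d x := by
    intro c d x hx hxp hf
    rw [Finset.mem_Ico] at hx
    exact hs.2.2.2 x (by omega) hx.2 (mirrorSuccessive_firstPal hletters hur hPE hw hnp hf.1).2.1
  refine Finset.sum_eq_single_of_mem p (Finset.mem_Ico.2 ⟨le_rfl, hs.1⟩) fun x hx hxp => ?_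
  rw [if_neg (hno c d x hx hxp), if_neg (hno d c x hx hxp), sub_self]

/-- The graph of centers, with an edge for each pair of consecutive palindromes. -/
def centerGraph : SimpleGraph (Option A) where
  Adj c d := ∃ p, FollowedAt u w c d p
  symm := ⟨fun _ _ ⟨_, h⟩ => h.exists_swap hletters hur hPE hw hnp⟩
  loopless := ⟨fun _ ⟨_, h⟩ => h.ne hletters hur hPE hw hnp rfl⟩

/-- Reading `u` from one palindrome to a later one traces a walk in the graph, and every center
occurs. -/
theorem Rich.connected_centerGraph (hrich : Rich u) :
    (centerGraph hletters hur hPE hw hnp).Connected := by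
  have key : ∀ n a b p q, q = p + n → OccursAt u (firstPal u w a) p →
      OccursAt u (firstPal u w b) q →
      (centerGraph hletters hur hPE hw hnp).Reachable a b := by
    intro n
    induction n using Nat.strong_induction_on with
    | _ n ih =>
      intro a b p q hpq ha hb
      rcases Nat.eq_zero_or_pos n with rfl | hn
      · rw [add_zero] at hpq
        subst hpq
        rw [eq_of_occursAt_firstPal hletters hur hPE hw hnp ha hb]
      · have hs := mirrorSuccessive_firstPal hletters hur hPE hw hnp ha
        have hle := hs.le_of_lt (mirrorSuccessive_firstPal hletters hur hPE hw hnp hb).2.1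
          (by omega)
        have hlt := hs.1
        obtain ⟨c, hc⟩ := hrich.exists_firstPal_occursAt hletters hur hPE hw hs.2.2.1
        have hac : (centerGraph hletters hur hPE hw hnp).Adj a c := ⟨p, ha, hc⟩
        exact hac.reachable.trans (ih (q - (p + (firstPal u w a).length - w.length)) (by omega)
          c b _ q (by omega) hc hb)
  refine ⟨fun a b => ?_⟩
  obtain ⟨p, hp⟩ := hPE.exists_occursAt_firstPal hletters w a
  obtain ⟨q, hq⟩ := hPE.exists_occursAt_firstPal hletters w b
  rcases le_total p q with h | h
  · exact key (q - p) a b p q (by omega) hp hq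
  · exact (key (p - q) b a q p (by omega) hq hp).symm

theorem Rich.isAcyclic_centerGraph (hrich : Rich u) :
    (centerGraph hletters hur hPE hw hnp).IsAcyclic := by
  classical
  rw [SimpleGraph.isAcyclic_iff_forall_isBridge]
  intro e
  induction e with | _ c d =>
  rintro ⟨p₀, h₀⟩
  rw [SimpleGraph.isBridge_iff]
  choose pos hpos using hPE.exists_occursAt_firstPal hletters w
  have hstep : ∀ {a b p}, FollowedAt u w a b p →
      potential u w c d (pos b) - potential u w c d (pos a) =
        (if FollowedAt u w c d p then 1 else 0) - (if FollowedAt u w d c p then 1 else 0) := by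
    intro a b p h
    rw [← h.potential_sub hletters hur hPE hw hnp c d,
      potential_eq_of_occursAt hletters hur hPE hw hnp hrich c d h.1 (hpos a),
      potential_eq_of_occursAt hletters hur hPE hw hnp hrich c d h.2 (hpos b)]
  have hinj : ∀ {a b c d p}, FollowedAt u w a b p → FollowedAt u w c d p → a = c ∧ b = d := by
    intro a b c d p h h'
    have hac := eq_of_occursAt_firstPal hletters hur hPE hw hnp h.1 h'.1
    subst hac
    exact ⟨rfl, eq_of_occursAt_firstPal hletters hur hPE hw hnp h.2 h'.2⟩
  rintro ⟨walk⟩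
  -- The potential changes only across the edge `c d`, where it rises by one; a walk avoiding that
  -- edge cannot join `c` to `d`.
  have hconst : ∀ {a b}, ((centerGraph hletters hur hPE hw hnp).deleteEdges {s(c, d)}).Walk a b →
      potential u w c d (pos a) = potential u w c d (pos b) := by
    intro a b walk
    induction walk with
    | nil => rfl
    | cons hadj _ ih =>
      rw [← ih]
      rw [SimpleGraph.deleteEdges_adj, Set.mem_singleton_iff] at hadj
      obtain ⟨⟨p, hf⟩, hne⟩ := hadj
      have h := hstep hf
      rw [if_neg, if_neg] at h
      · linarith
      · intro h'
        obtain ⟨rfl, rfl⟩ := hinj hf h'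
        exact hne Sym2.eq_swap
      · intro h'
        obtain ⟨rfl, rfl⟩ := hinj hf h'
        exact hne rfl
  have h := hstep h₀
  rw [if_pos h₀, if_neg, hconst walk] at h
  · simp at h
  · intro h'
    exact h₀.ne hletters hur hPE hw hnp (hinj h₀ h').1

end

/-! ### Edges of the tree and return words -/

/-- The pairs of centers of consecutive palindromes, the first of which starts with `w`. -/
def centerPairs (u : ℕ → A) (w : List A) : Set (Option A × Option A) :=
  {x | (∃ p, FollowedAt u w x.1 x.2 p) ∧ w <+: firstPal u w x.1}

/-- The word read along two consecutive palindromes, up to the last occurrence of `w`. -/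
noncomputable def pairReturn (u : ℕ → A) (w : List A) (x : Option A × Option A) : List A :=
  (firstPal u w x.1).take ((firstPal u w x.1).length - w.length) ++
    (firstPal u w x.2).take ((firstPal u w x.2).length - w.length)

section

variable (hletters : Function.Surjective u) (hur : UniformlyRecurrent u) (hPE : PropertyPE u)
  {w : List A} (hw : w ∈ language u) (hnp : ¬ w.Palindrome)

include hletters hur hPE hw hnp

theorem image_centerPairs_edges :
    (fun x : Option A × Option A => s(x.1, x.2)) '' centerPairs u w =
      (centerGraph hletters hur hPE hw hnp).edgeSet := by
  ext e
  induction e with | _ c d =>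
  constructor
  · rintro ⟨x, ⟨h, -⟩, hx⟩
    rw [← hx]
    exact h
  · rintro ⟨p, h⟩
    by_cases hc : w <+: firstPal u w c
    · exact ⟨(c, d), ⟨⟨p, h⟩, hc⟩, rfl⟩
    · have hd : w <+: firstPal u w d := by
        have := h.prefix_iff hletters hur hPE hw hnp
        tauto
      exact ⟨(d, c), ⟨h.exists_swap hletters hur hPE hw hnp, hd⟩, Sym2.eq_swap⟩

/-- The 2-coloring allows only one orientation of each edge. -/
theorem injOn_centerPairs_edges :
    Set.InjOn (fun x : Option A × Option A => s(x.1, x.2)) (centerPairs u w) := by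
  rintro ⟨c, d⟩ ⟨⟨p, h⟩, hc⟩ ⟨c', d'⟩ ⟨-, hc'⟩ heq
  rcases Sym2.eq_iff.1 heq with ⟨rfl, rfl⟩ | ⟨rfl, rfl⟩
  · rfl
  · exact absurd hc' ((h.prefix_iff hletters hur hPE hw hnp).1 hc)

theorem length_pairReturn (c d : Option A) : (pairReturn u w (c, d)).length + 2 * w.length =
    (firstPal u w c).length + (firstPal u w d).length := by
  have h1 := length_lt_firstPal_of_not_palindrome hletters hur hPE hw hnp c
  have h2 := length_lt_firstPal_of_not_palindrome hletters hur hPE hw hnp d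
  simp only [pairReturn, List.length_append, List.length_take]
  omega

theorem FollowedAt.occursAt_pairReturn {c d : Option A} {p : ℕ} (h : FollowedAt u w c d p) :
    OccursAt u (pairReturn u w (c, d)) p := by
  have h1 := length_lt_firstPal_of_not_palindrome hletters hur hPE hw hnp c
  rw [pairReturn, occursAt_append]
  refine ⟨h.1.of_prefix (List.take_prefix _ _), ?_⟩
  have := h.2.of_prefix (List.take_prefix ((firstPal u w d).length - w.length) _)
  convert this using 1
  rw [List.length_take]
  dsimp only
  omega

/-- The palindromes meet in the reversal of `w`, so `w` recurs only at the end of the second one. -/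
theorem FollowedAt.successiveOccurrences {c d : Option A} {p : ℕ} (h : FollowedAt u w c d p)
    (hc : w <+: firstPal u w c) :
    SuccessiveOccurrences u w p (p + (pairReturn u w (c, d)).length) := by
  have hl := length_pairReturn hletters hur hPE hw hnp c d
  have h1 := length_lt_firstPal_of_not_palindrome hletters hur hPE hw hnp c
  have h2 := length_lt_firstPal_of_not_palindrome hletters hur hPE hw hnp d
  have s1 := mirrorSuccessive_firstPal hletters hur hPE hw hnp h.1
  have s2 := mirrorSuccessive_firstPal hletters hur hPE hw hnp h.2
  have hp := h.1.of_prefix hc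
  have o1 := (occursAt_iff_not_occursAt hletters hur hPE hw hnp h.1).1 hp
  have o2 := not_not.1 (mt (occursAt_iff_not_occursAt hletters hur hPE hw hnp h.2).2 o1)
  have hpos : p + (firstPal u w c).length - w.length + (firstPal u w d).length - w.length =
      p + (pairReturn u w (c, d)).length := by omega
  rw [hpos] at o2 s2
  refine ⟨by omega, hp, o2, fun l hpl hl hol => ?_⟩
  rcases (s1.le_of_lt (Or.inl hol) hpl).eq_or_lt with h | h
  · exact o1 (h ▸ hol)
  · exact s2.2.2.2 l h hl (Or.inl hol)

theorem injOn_pairReturn : Set.InjOn (pairReturn u w) (centerPairs u w) := by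
  rintro ⟨c, d⟩ ⟨⟨p, h⟩, hc⟩ ⟨c', d'⟩ ⟨⟨p', h'⟩, hc'⟩ heq
  dsimp only at h hc h' hc'
  have h1 := length_lt_firstPal_of_not_palindrome hletters hur hPE hw hnp c
  have h2 := length_lt_firstPal_of_not_palindrome hletters hur hPE hw hnp d
  have hl := length_pairReturn hletters hur hPE hw hnp c d
  -- Appending `w` restores the full union of the two palindromes, from which both centers can be
  -- read off.
  have o := occursAt_append.2 ⟨h.occursAt_pairReturn hletters hur hPE hw hnp,
    (h.successiveOccurrences hletters hur hPE hw hnp hc).2.2.1⟩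
  have o' := occursAt_append.2 ⟨h'.occursAt_pairReturn hletters hur hPE hw hnp,
    (h'.successiveOccurrences hletters hur hPE hw hnp hc').2.2.1⟩
  rw [← heq] at o'
  have k1 := o.transfer o' (j := 0) h.1 (by rw [List.length_append]; omega)
  have hcc := eq_of_occursAt_firstPal hletters hur hPE hw hnp k1 h'.1
  subst hcc
  have k2 := o.transfer o' (j := (firstPal u w c).length - w.length) (w := firstPal u w d)
    (by convert h.2 using 1; omega) (by rw [List.length_append]; omega)
  have hdd := eq_of_occursAt_firstPal hletters hur hPE hw hnp k2
    (by convert h'.2 using 1; omega)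
  rw [hdd]

theorem Rich.image_pairReturn (hrich : Rich u) :
    pairReturn u w '' centerPairs u w = returnWords u w := by
  ext v
  constructor
  · rintro ⟨⟨c, d⟩, ⟨⟨p, h⟩, hc⟩, rfl⟩
    refine ⟨p, _, h.successiveOccurrences hletters hur hPE hw hnp hc, ?_⟩
    rw [Nat.add_sub_cancel_left]
    exact (h.occursAt_pairReturn hletters hur hPE hw hnp).eq_block
  · rintro ⟨p, q, hpq, rfl⟩
    obtain ⟨c, hc⟩ := hrich.exists_firstPal_occursAt hletters hur hPE hw (Or.inl hpq.2.1)
    obtain ⟨d, hd⟩ := hrich.exists_firstPal_occursAt hletters hur hPE hw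
      (mirrorSuccessive_firstPal hletters hur hPE hw hnp hc).2.2.1
    have hf : FollowedAt u w c d p := ⟨hc, hd⟩
    have hpre := (occursAt_iff_prefix hletters hur hPE hw hnp hc).1 hpq.2.1
    refine ⟨(c, d), ⟨⟨p, hf⟩, hpre⟩, ?_⟩
    have hs := hf.successiveOccurrences hletters hur hPE hw hnp hpre
    have hq : q = p + (pairReturn u w (c, d)).length := by
      refine le_antisymm ?_ ?_
      · by_contra hlt
        exact hpq.2.2.2 _ hs.1 (by omega) hs.2.2.1
      · by_contra hlt
        exact hs.2.2.2 _ hpq.1 (by omega) hpq.2.2.1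
    rw [hq, Nat.add_sub_cancel_left]
    exact (hf.occursAt_pairReturn hletters hur hPE hw hnp).eq_block

theorem Rich.encard_returnWords_of_not_palindrome [Finite A] (hrich : Rich u) :
    (returnWords u w).encard = ENat.card A := by
  classical
  have := Fintype.ofFinite A
  rw [← hrich.image_pairReturn hletters hur hPE hw hnp,
    (injOn_pairReturn hletters hur hPE hw hnp).encard_image,
    ← (injOn_centerPairs_edges hletters hur hPE hw hnp).encard_image,
    image_centerPairs_edges hletters hur hPE hw hnp]
  have htree : (centerGraph hletters hur hPE hw hnp).IsTree :=
    ⟨hrich.connected_centerGraph hletters hur hPE hw hnp,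
      hrich.isAcyclic_centerGraph hletters hur hPE hw hnp⟩
  have hcard := htree.card_edgeFinset
  rw [Fintype.card_option, add_left_inj] at hcard
  rw [← SimpleGraph.coe_edgeFinset, Set.encard_coe_eq_coe_finsetCard, hcard,
    ENat.card_eq_coe_fintype_card]

end

end InfWord

theorem mainTheorem5 {A : Type*} [Finite A] (u : ℕ → A) (hletters : Function.Surjective u)
    (hur : InfWord.UniformlyRecurrent u) (hPE : InfWord.PropertyPE u) :
    InfWord.Rich u ↔ InfWord.PropertyR u := by
  refine ⟨fun hrich w hw => ?_, fun hR => hR.rich hletters hur hPE⟩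
  by_cases hp : w.Palindrome
  · exact hrich.encard_returnWords_of_palindrome hletters hur hPE hw hp
  · exact hrich.encard_returnWords_of_not_palindrome hletters hur hPE hw hp
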